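/- Let $0<a\le b$, let $A\in\mathbb C^{n\times n}$ be Hermitian positive definite with spectrum contained in $[a,b]$, let $v\in\mathbb C^{n\times s}$ be a (block) vector, let $\ell\ge 1$, and let $\Psi=(\psi_1,\dots,\psi_\ell)$ be real poles with $\psi_j\in[-b,-a]$ (repetitions allowed). Put $q(z)=\prod_{j=1}^{\ell}(z-\psi_j)$ and let $U\in\mathbb C^{n\times k}$ be a matrix whose columns form an orthonormal basis of the rational Krylov subspace $$\mathcal{RK}_\ell(A,v,\Psi)=\operatorname{span}\{q(A)^{-1}v,\;q(A)^{-1}Av,\;\dots,\;q(A)^{-1}A^{\ell}v\}\subseteq\mathbb C^n$$ (for $s>1$: the span of all the columns of these matrices). Let $A_\ell=U^*AU$, $v_\ell=U^*v$, $\kappa=b/a$, $$r_\Psi(z)=\prod_{j=1}^{\ell}\frac{z+\psi_j}{z-\psi_j},\qquad \gamma_{\ell,\kappa}=2.23+\frac{2}{\pi}\log\!\Big(4\ell\sqrt{\frac{\kappa}{\pi}}\Big).$$ Then, for every $t\in[0,\infty)$, $$\big\|e^{-tA}v-U\,e^{-tA_\ell}\,v_\ell\big\|_2\;\le\;4\,\gamma_{\ell,\kappa}\,\|v\|_2\,\max_{z\in[a,b]}|r_\Psi(z)|,$$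 where $\|\cdot\|_2$ is the Euclidean norm for vectors and the spectral norm for block vectors. -/

import Mathlib

open scoped Matrix.Norms.L2Operator ComplexOrder

noncomputable section

namespace RatKrylov

/-- `q(z) = ∏ⱼ (z - ψⱼ)`, the denominator attached to a tuple of finite poles (repetitions count). -/
def poleDenom {l : ℕ} (ψ : Fin l → ℂ) : Polynomial ℂ :=
  ∏ j, (Polynomial.X - Polynomial.C (ψ j))

/-- The rational Krylov subspace with finite poles `ψ₁, …, ψ_l` generated by `A` and the (block)
vector `v`: the span of the columns of `q(A)⁻¹ v, q(A)⁻¹ A v, …, q(A)⁻¹ A ^ l v`. -/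
def rationalKrylov {n s l : ℕ} (A : Matrix (Fin n) (Fin n) ℂ) (v : Matrix (Fin n) (Fin s) ℂ)
    (ψ : Fin l → ℂ) : Submodule ℂ (Fin n → ℂ) :=
  Submodule.span ℂ
    {w | ∃ i ≤ l, ∃ c : Fin s, w = ((Polynomial.aeval A (poleDenom ψ))⁻¹ * A ^ i * v).col c}

/-- The columns of `U` form a basis of `W`, orthonormal for the standard inner product. -/
def IsOrthonormalBasisOf {n k : ℕ} (U : Matrix (Fin n) (Fin k) ℂ)
    (W : Submodule ℂ (Fin n → ℂ)) : Prop :=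
  U.conjTranspose * U = 1 ∧ Submodule.span ℂ (Set.range U.col) = W

/-- `r_Ψ(z) = ∏ⱼ (z + ψⱼ) / (z - ψⱼ)` for real poles. -/
def rPole {l : ℕ} (ψ : Fin l → ℝ) (z : ℝ) : ℝ :=
  ∏ j, (z + ψ j) / (z - ψ j)

/-- `γ_{l,κ} = 2.23 + (2 / π) log (4 l √(κ / π))`. -/
def gammaConst (l : ℕ) (κ : ℝ) : ℝ :=
  2.23 + 2 / Real.pi * Real.log (4 * l * Real.sqrt (κ / Real.pi))

end RatKrylov

end

/-! Rational functions `P / q` with `deg P ≤ l` are reproduced exactly by the Krylov projection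
(`rational_mul_eq_compression`). Subtracting one such function `R` leaves `(exp(-tA) - R(A)) v` and
the same defect for the compression, whose spectrum also lies in `[a, b]`. The functional calculus
bounds each by `‖v‖` times the scalar error of `R` on `[a, b]`, so it remains to find `R` with error
at most `2 γ |r_Ψ(x)|`.

With `pⱼ = -ψⱼ` and Blaschke products `B_j`, expand the Laplace transform of `exp(-tx)`: `1/(s+x) =
∑_{j<l} τ_j(x) B_j(s)/(s+p_j) + B_l(x) B_l(s)/(s+x)`, where `τ_j` is `takenaka p j`. Inverting in
`s` makes the sum a rational function of `x` with denominator `q`, and the remainder is `B_l(x)`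
times the inverse transform of `B_l(s)/(s+x)` (`exp_sub_sum_takenaka`). Writing `B_l = 1 + (B_l -
1)` splits that factor into `exp(-tx) ≤ 1` and an absolutely convergent integral over the imaginary
axis, which grows only like `log(l b / a)` because `|B_l| = 1` there (`blaschke_integrand_bound`).
-/

namespace RatKrylov

open MeasureTheory Set

/-! ### Blaschke products and the Takenaka–Malmquist expansion. -/

section RationalFunctions

/-- The finite Blaschke product `∏ᵢ (z - pᵢ) / (z + pᵢ)` over `i < l`. -/
noncomputable def blaschke (p : ℕ → ℝ) (l : ℕ) (z : ℂ) : ℂ :=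
  ∏ i ∈ Finset.range l, (z - p i) / (z + p i)

/-- The Takenaka–Malmquist function `2 pⱼ / (z + pⱼ) ∏ᵢ (z - pᵢ) / (z + pᵢ)`, product over `i < j`. -/
noncomputable def takenaka (p : ℕ → ℝ) (j : ℕ) (z : ℂ) : ℂ :=
  2 * p j / (z + p j) * blaschke p j z

lemma blaschke_succ (p : ℕ → ℝ) (l : ℕ) (z : ℂ) :
    blaschke p (l + 1) z = blaschke p l z * ((z - p l) / (z + p l)) :=
  Finset.prod_range_succ _ _

/-- Limit `s → ∞` of the Christoffel–Darboux type identity `one_sub_blaschke_mul_blaschke`; both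
telescope. -/
lemma one_sub_blaschke {p : ℕ → ℝ} {z : ℂ} (hz : ∀ i, z + p i ≠ 0) (l : ℕ) :
    1 - blaschke p l z = ∑ j ∈ Finset.range l, takenaka p j z := by
  induction l with
  | zero => simp [blaschke]
  | succ l ih =>
    rw [Finset.sum_range_succ, ← ih, blaschke_succ, takenaka]
    have := hz l
    field_simp
    ring

lemma one_sub_blaschke_mul_blaschke {p : ℕ → ℝ} {z s : ℂ} (hz : ∀ i, z + p i ≠ 0)
    (hs : ∀ i, s + p i ≠ 0) (l : ℕ) :
    1 - blaschke p l z * blaschke p l s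
      = (s + z) * ∑ j ∈ Finset.range l, takenaka p j z * (blaschke p j s / (s + p j)) := by
  induction l with
  | zero => simp [blaschke]
  | succ l ih =>
    rw [Finset.sum_range_succ, mul_add, ← ih, blaschke_succ, blaschke_succ, takenaka]
    have := hz l
    have := hs l
    field_simp
    ring

/-- A combination of Takenaka–Malmquist functions has a numerator of degree at most `l`. -/
lemma exists_polynomial_sum_takenaka (p : ℕ → ℝ) (c : ℕ → ℂ) (l : ℕ) :
    ∃ P : Polynomial ℂ, P.natDegree ≤ l ∧ ∀ z : ℂ, (∀ i, z + p i ≠ 0) →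
      ∑ j ∈ Finset.range l, c j * takenaka p j z
        = P.eval z * (∏ i ∈ Finset.range l, (z + p i))⁻¹ := by
  induction l with
  | zero => exact ⟨0, by simp⟩
  | succ l ih =>
    obtain ⟨P, hP, h⟩ := ih
    refine ⟨P * (Polynomial.X + Polynomial.C (p l : ℂ)) + Polynomial.C (c l * (2 * p l)) *
      ∏ i ∈ Finset.range l, (Polynomial.X - Polynomial.C (p i : ℂ)), ?_, fun z hz => ?_⟩
    · refine (Polynomial.natDegree_add_le _ _).trans (max_le ?_ ?_)
      · refine Polynomial.natDegree_mul_le.trans ?_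
        rw [Polynomial.natDegree_X_add_C]
        omega
      · refine (Polynomial.natDegree_C_mul_le _ _).trans ?_
        refine (Polynomial.natDegree_prod_le _ _).trans ?_
        simp
    · rw [Finset.sum_range_succ, h z hz, Finset.prod_range_succ, takenaka, blaschke,
        Finset.prod_div_distrib]
      have h1 := hz l
      have h2 : ∏ i ∈ Finset.range l, (z + (p i : ℂ)) ≠ 0 :=
        Finset.prod_ne_zero_iff.mpr fun i _ => hz i
      simp only [Polynomial.eval_add, Polynomial.eval_mul, Polynomial.eval_X, Polynomial.eval_C,
        Polynomial.eval_prod, Polynomial.eval_sub]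
      field_simp

lemma norm_blaschke_of_re_eq_zero {p : ℕ → ℝ} (hp : ∀ i, 0 < p i) (l : ℕ) {s : ℂ}
    (hs : s.re = 0) : ‖blaschke p l s‖ = 1 := by
  rw [blaschke, norm_prod]
  refine Finset.prod_eq_one fun i _ => ?_
  have hne : s + p i ≠ 0 := fun h => by
    have := congrArg Complex.re h
    simp [hs] at this
    exact (hp i).ne' this
  rw [norm_div, div_eq_one_iff_eq (norm_ne_zero_iff.mpr hne), ← sq_eq_sq₀ (norm_nonneg _)
    (norm_nonneg _), Complex.sq_norm, Complex.sq_norm, Complex.normSq_apply, Complex.normSq_apply]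
  simp [hs]

lemma add_ofReal_ne_zero {s : ℂ} (hs : 0 ≤ s.re) {x : ℝ} (hx : 0 < x) : s + x ≠ 0 := fun h => by
  have := congrArg Complex.re h
  simp at this
  linarith

lemma abs_im_le_norm_add_ofReal (s : ℂ) (x : ℝ) : |s.im| ≤ ‖s + x‖ := by
  simpa using Complex.abs_im_le_norm (s + x)

lemma le_norm_add_ofReal {s : ℂ} (hs : s.re = 0) (x : ℝ) : x ≤ ‖s + x‖ := by
  have := Complex.re_le_norm (s + x)
  simpa [hs] using this

/-- Each new factor is `1 - 2 p_l / (s + p_l)` and multiplies a number of modulus one, so it moves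
the product by at most `2 b / |s.im|`. This supplies the extra decay at infinity. -/
lemma norm_blaschke_sub_one_mul_abs_im_le {p : ℕ → ℝ} (hp : ∀ i, 0 < p i) {b : ℝ}
    (hb : ∀ i, p i ≤ b) (l : ℕ) {s : ℂ} (hs : s.re = 0) :
    ‖blaschke p l s - 1‖ * |s.im| ≤ 2 * (l * b) := by
  induction l with
  | zero => simp [blaschke]
  | succ l ih =>
    have hne : s + p l ≠ 0 := add_ofReal_ne_zero hs.ge (hp l)
    have e : blaschke p (l + 1) s - 1
        = (blaschke p l s - 1) - blaschke p l s * (2 * p l / (s + p l)) := by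
      rw [blaschke_succ]
      field_simp
      ring
    have h1 : ‖blaschke p l s * (2 * p l / (s + p l))‖ * |s.im| ≤ 2 * b := by
      rw [norm_mul, norm_blaschke_of_re_eq_zero hp l hs, one_mul, norm_div, div_mul_eq_mul_div,
        div_le_iff₀ (norm_pos_iff.mpr hne)]
      have : ‖(2 * p l : ℂ)‖ = 2 * p l := by
        rw [norm_mul, Complex.norm_real, Real.norm_of_nonneg (hp l).le]
        simp
      rw [this]
      have := hb l
      have := (hp l).le
      exact mul_le_mul (by linarith) (abs_im_le_norm_add_ofReal s _) (abs_nonneg _) (by linarith)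
    calc ‖blaschke p (l + 1) s - 1‖ * |s.im|
        ≤ (‖blaschke p l s - 1‖ + ‖blaschke p l s * (2 * p l / (s + p l))‖) * |s.im| := by
          rw [e]
          exact mul_le_mul_of_nonneg_right (norm_sub_le _ _) (abs_nonneg _)
      _ ≤ 2 * ((l + 1 : ℕ) * b) := by
          push_cast
          linarith

end RationalFunctions

/-! ### Integrals dominated by a constant, by `1 / y` and by `1 / y²`. -/

section IntegralBounds

/-- The three bounds are used on `(0, α]`, `(α, β]` and `(β, ∞)` respectively. -/
lemma integrableOn_norm_and_setIntegral_norm_le {H : ℝ → ℂ} (hH : Continuous H) {K B C α β : ℝ}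
    (hα : 0 < α) (hαβ : α ≤ β) (hK : ∀ y, 0 < y → ‖H y‖ ≤ K) (hB : ∀ y, 0 < y → ‖H y‖ ≤ B * y⁻¹)
    (hC : ∀ y, 0 < y → ‖H y‖ ≤ C * y ^ (-2 : ℝ)) :
    IntegrableOn (fun y => ‖H y‖) (Ioi 0) ∧
      ∫ y in Ioi 0, ‖H y‖ ≤ K * α + B * Real.log (β / α) + C / β := by
  have hβ : 0 < β := hα.trans_le hαβ
  have hc : Continuous fun y => ‖H y‖ := hH.norm
  have i3' : IntegrableOn (fun y : ℝ => C * y ^ (-2 : ℝ)) (Ioi β) :=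
    (integrableOn_Ioi_rpow_of_lt (by norm_num) hβ).const_mul C
  have i3 : IntegrableOn (fun y => ‖H y‖) (Ioi β) := by
    refine Integrable.mono' i3' hc.aestronglyMeasurable ?_
    filter_upwards [ae_restrict_mem measurableSet_Ioi] with y hy
    rw [norm_norm]
    exact hC y (hβ.trans hy)
  have i1 : IntegrableOn (fun y => ‖H y‖) (Ioc 0 α) := hc.integrableOn_Ioc
  have i2 : IntegrableOn (fun y => ‖H y‖) (Ioc α β) := hc.integrableOn_Ioc
  have i23 : IntegrableOn (fun y => ‖H y‖) (Ioi α) := by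
    rw [← Ioc_union_Ioi_eq_Ioi hαβ]; exact i2.union i3
  have i123 : IntegrableOn (fun y => ‖H y‖) (Ioi 0) := by
    rw [← Ioc_union_Ioi_eq_Ioi hα.le]; exact i1.union i23
  refine ⟨i123, ?_⟩
  rw [← Ioc_union_Ioi_eq_Ioi hα.le, setIntegral_union Ioc_disjoint_Ioi_same measurableSet_Ioi i1 i23,
    ← Ioc_union_Ioi_eq_Ioi hαβ, setIntegral_union Ioc_disjoint_Ioi_same measurableSet_Ioi i2 i3,
    ← add_assoc]
  refine add_le_add (add_le_add ?_ ?_) ?_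
  · have := setIntegral_mono_on (g := fun _ => K) i1 (by simp) measurableSet_Ioc
      fun y hy => hK y hy.1
    refine this.trans_eq ?_
    simp [hα.le, mul_comm]
  · have hi : IntegrableOn (fun y : ℝ => B * y⁻¹) (Ioc α β) := by
      refine (ContinuousOn.integrableOn_Icc ?_).mono_set Ioc_subset_Icc_self
      exact continuousOn_const.mul (continuousOn_id.inv₀ fun y hy => (hα.trans_le hy.1).ne')
    have := setIntegral_mono_on i2 hi measurableSet_Ioc fun y hy => hB y (hα.trans hy.1)
    refine this.trans_eq ?_
    rw [← intervalIntegral.integral_of_le hαβ, intervalIntegral.integral_const_mul,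
      integral_inv_of_pos hα hβ]
  · have := setIntegral_mono_on i3 i3' measurableSet_Ioi fun y hy => hC y (hβ.trans hy)
    refine this.trans_eq ?_
    rw [integral_const_mul, integral_Ioi_rpow_of_lt (by norm_num) hβ]
    norm_num [Real.rpow_neg_one]
    rfl

lemma integrable_norm_and_integral_norm_le {H : ℝ → ℂ} (hH : Continuous H) {K B C α β : ℝ}
    (hα : 0 < α) (hαβ : α ≤ β) (hK : ∀ y, ‖H y‖ ≤ K) (hB : ∀ y, y ≠ 0 → ‖H y‖ ≤ B * |y|⁻¹)
    (hC : ∀ y, y ≠ 0 → ‖H y‖ ≤ C * |y| ^ (-2 : ℝ)) :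
    Integrable H ∧ ∫ y, ‖H y‖ ≤ 2 * (K * α + B * Real.log (β / α) + C / β) := by
  obtain ⟨i1, h1⟩ := integrableOn_norm_and_setIntegral_norm_le hH hα hαβ (K := K) (B := B) (C := C)
    (fun y _ => hK y) (fun y hy => by simpa [abs_of_pos hy] using hB y hy.ne')
    (fun y hy => by simpa only [abs_of_pos hy] using hC y hy.ne')
  obtain ⟨i2, h2⟩ := integrableOn_norm_and_setIntegral_norm_le (H := fun y => H (-y)) (hH.comp continuous_neg)
    hα hαβ (K := K) (B := B) (C := C)
    (fun y _ => hK _) (fun y hy => by simpa [abs_of_pos hy] using hB (-y) (neg_ne_zero.mpr hy.ne'))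
    (fun y hy => by simpa only [abs_neg, abs_of_pos hy] using hC (-y) (neg_ne_zero.mpr hy.ne'))
  have i3 : IntegrableOn (fun y => ‖H y‖) (Iic 0) := by
    rw [integrableOn_Iic_iff_integrableOn_Iio]
    rw [← neg_zero] at i2
    have := IntegrableOn.comp_neg_Iio (c := (0 : ℝ)) (f := fun y => ‖H (-y)‖) i2
    simpa only [neg_neg] using this
  have i : Integrable (fun y => ‖H y‖) := by
    rw [← integrableOn_univ, ← Iic_union_Ioi (a := (0 : ℝ))]
    exact i3.union i1
  refine ⟨(integrable_norm_iff hH.aestronglyMeasurable).mp i, ?_⟩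
  rw [← intervalIntegral.integral_Iic_add_Ioi i3 i1]
  rw [integral_comp_neg_Ioi (0 : ℝ) (fun y => ‖H y‖), neg_zero] at h2
  linarith

end IntegralBounds

end RatKrylov

namespace RatKrylov

open MeasureTheory Set FourierTransform

/-! ### Inverse Laplace transforms along the imaginary axis. -/

section InverseLaplace

/-- The point `2 π i y` of the imaginary axis. -/
noncomputable def imAxis (y : ℝ) : ℂ := (2 * Real.pi * y : ℝ) * Complex.I

@[simp] lemma imAxis_re (y : ℝ) : (imAxis y).re = 0 := by simp [imAxis]

@[simp] lemma imAxis_im (y : ℝ) : (imAxis y).im = 2 * Real.pi * y := by simp [imAxis]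

lemma continuous_imAxis : Continuous imAxis := by unfold imAxis; fun_prop

lemma imAxis_add_ne_zero (y : ℝ) {x : ℝ} (hx : 0 < x) : imAxis y + x ≠ 0 :=
  add_ofReal_ne_zero (imAxis_re y).ge hx

lemma norm_exp_imAxis_mul (y t : ℝ) : ‖Complex.exp (imAxis y * t)‖ = 1 := by
  simp [Complex.norm_exp]

/-- The inverse Laplace transform as an integral over the imaginary axis. -/
noncomputable def invLaplace (F : ℂ → ℂ) (t : ℝ) : ℂ :=
  ∫ y : ℝ, Complex.exp (imAxis y * t) * F (imAxis y)

lemma continuous_blaschke_imAxis {p : ℕ → ℝ} (hp : ∀ i, 0 < p i) (l : ℕ) :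
    Continuous fun y => blaschke p l (imAxis y) := by
  unfold blaschke
  refine continuous_finsetProd _ fun i _ => ?_
  exact (continuous_imAxis.sub continuous_const).div (continuous_imAxis.add continuous_const)
    fun y => imAxis_add_ne_zero y (hp i)

lemma blaschke_integrand_bound {p : ℕ → ℝ} {a b x t : ℝ} (ha : 0 < a) (hp : ∀ i, p i ∈ Icc a b)
    (hx : a ≤ x) {l : ℕ} (hl : 1 ≤ l) :
    Integrable (fun y => Complex.exp (imAxis y * t) * ((blaschke p l (imAxis y) - 1) / (imAxis y + x))) ∧
    ∫ y, ‖Complex.exp (imAxis y * t) * ((blaschke p l (imAxis y) - 1) / (imAxis y + x))‖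
      ≤ (4 + 2 * Real.log (l * (b / a))) / Real.pi := by
  have hp0 : ∀ i, 0 < p i := fun i => ha.trans_le (hp i).1
  have hx0 : 0 < x := ha.trans_le hx
  have hab : a ≤ b := (hp 0).1.trans (hp 0).2
  have hb : 0 < b := ha.trans_le hab
  have hl0 : (1 : ℝ) ≤ l := by exact_mod_cast hl
  have hL : a ≤ l * b := by nlinarith
  have hL0 : 0 < l * b := ha.trans_le hL
  have hpi := Real.pi_pos
  have hn : ∀ y, ‖Complex.exp (imAxis y * t) * ((blaschke p l (imAxis y) - 1) / (imAxis y + x))‖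
      = ‖blaschke p l (imAxis y) - 1‖ / ‖imAxis y + x‖ := fun y => by
    rw [norm_mul, norm_exp_imAxis_mul, one_mul, norm_div]
  have h2 : ∀ y, ‖blaschke p l (imAxis y) - 1‖ ≤ 2 := fun y =>
    (norm_sub_le _ _).trans (by
      rw [norm_blaschke_of_re_eq_zero hp0 l (imAxis_re y)]; norm_num)
  have h3 : ∀ y, y ≠ 0 → ‖blaschke p l (imAxis y) - 1‖ ≤ 2 * (l * b) / (2 * Real.pi * |y|) :=
    fun y hy => by
      have hy' := abs_pos.mpr hy
      have := norm_blaschke_sub_one_mul_abs_im_le hp0 (fun i => (hp i).2) l (imAxis_re y)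
      rw [imAxis_im, abs_mul, abs_of_pos (by positivity : 0 < 2 * Real.pi)] at this
      rwa [le_div_iff₀ (by positivity)]
  have h4 : ∀ y, a ≤ ‖imAxis y + x‖ := fun y => hx.trans (le_norm_add_ofReal (imAxis_re y) x)
  have h5 : ∀ y, 2 * Real.pi * |y| ≤ ‖imAxis y + x‖ := fun y => by
    have := abs_im_le_norm_add_ofReal (imAxis y) x
    rwa [imAxis_im, abs_mul, abs_of_pos (by positivity : 0 < 2 * Real.pi)] at this
  -- With `ω = 2πy`, the numerator is at most `min(2, 2lb/|ω|)` and the denominator at least `max(a,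
  -- |ω|)`. The cut points are `|ω| = a` and `|ω| = l b`, where consecutive bounds agree.
  have key := integrable_norm_and_integral_norm_le
    (H := fun y => Complex.exp (imAxis y * t) * ((blaschke p l (imAxis y) - 1) / (imAxis y + x)))
    (K := 2 / a) (B := 1 / Real.pi) (C := 2 * (l * b) / (4 * Real.pi ^ 2))
    (α := a / (2 * Real.pi)) (β := l * b / (2 * Real.pi)) ?_ (by positivity) (by gcongr) ?_ ?_ ?_
  · refine ⟨key.1, key.2.trans_eq ?_⟩
    have : l * b / (2 * Real.pi) / (a / (2 * Real.pi)) = l * (b / a) := by field_simp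
    rw [this]
    field_simp
    ring
  · refine (Complex.continuous_exp.comp (continuous_imAxis.mul continuous_const)).mul ?_
    exact ((continuous_blaschke_imAxis hp0 l).sub continuous_const).div
      (continuous_imAxis.add continuous_const) fun y => imAxis_add_ne_zero y hx0
  · intro y
    rw [hn]
    exact div_le_div₀ zero_le_two (h2 y) ha (h4 y)
  · intro y hy
    have hy' := abs_pos.mpr hy
    rw [hn]
    refine (div_le_div₀ zero_le_two (h2 y) (by positivity) (h5 y)).trans_eq ?_
    field_simp
  · intro y hy
    have hy' := abs_pos.mpr hy
    rw [hn]
    refine (div_le_div₀ (by positivity) (h3 y hy) (by positivity) (h5 y)).trans_eq ?_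
    rw [Real.rpow_neg hy'.le, Real.rpow_two]
    field_simp
    norm_num

lemma integrable_blaschke_integrand {p : ℕ → ℝ} {a b x : ℝ} (ha : 0 < a)
    (hp : ∀ i, p i ∈ Icc a b) (hx : a ≤ x) (l : ℕ) (t : ℝ) :
    Integrable fun y => Complex.exp (imAxis y * t) * ((blaschke p l (imAxis y) - 1) / (imAxis y + x)) := by
  rcases Nat.eq_zero_or_pos l with rfl | hl
  · simp [blaschke]
  · exact (blaschke_integrand_bound ha hp hx hl).1

lemma norm_invLaplace_blaschke_le {p : ℕ → ℝ} {a b x t : ℝ} (ha : 0 < a) (hp : ∀ i, p i ∈ Icc a b)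
    (hx : a ≤ x) {l : ℕ} (hl : 1 ≤ l) :
    ‖invLaplace (fun s => (blaschke p l s - 1) / (s + x)) t‖
      ≤ (4 + 2 * Real.log (l * (b / a))) / Real.pi :=
  (norm_integral_le_integral_norm _).trans (blaschke_integrand_bound ha hp hx hl).2

lemma integrable_inv_sub_inv {x p : ℝ} (hx : 0 < x) (hp : 0 < p) (t : ℝ) :
    Integrable fun y => Complex.exp (imAxis y * t) * ((imAxis y + x)⁻¹ - (imAxis y + p)⁻¹) := by
  -- For one factor, `(B₁(s) - 1)/(s + x) = -2p / ((s + p)(s + x))`, a multiple of the difference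
  -- sought.
  have h := (integrable_blaschke_integrand (p := fun _ => p) (b := p) (lt_min hx hp)
    (fun _ => ⟨min_le_right x p, le_rfl⟩) (min_le_left x p) 1 t).const_mul ((x - p) / (2 * p) : ℂ)
  refine h.congr (Filter.Eventually.of_forall fun y => ?_)
  have h1 := imAxis_add_ne_zero y hx
  have h2 := imAxis_add_ne_zero y hp
  have h3 : (p : ℂ) ≠ 0 := by exact_mod_cast hp.ne'
  simp only [blaschke, Finset.prod_range_one]
  field_simp
  ring

lemma integrableOn_exp_neg_add {x : ℝ} (hx : 0 < x) (s : ℂ) (hs : s.re = 0) :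
    IntegrableOn (fun t : ℝ => Complex.exp (-(s + x) * t)) (Ioi 0) :=
  integrableOn_exp_mul_complex_Ioi (by simp [hs, hx]) 0

/-- Fourier inversion needs a continuous function with integrable transform. A single causal
exponential jumps at `0`; in the difference of two the jumps cancel. -/
lemma invLaplace_inv_sub_inv {x p : ℝ} (hx : 0 < x) (hp : 0 < p) {t : ℝ} (ht : 0 ≤ t) :
    invLaplace (fun s => (s + x)⁻¹ - (s + p)⁻¹) t
      = Complex.exp (-(t * x)) - Complex.exp (-(t * p)) := by
  -- The truncation `max t 0` makes `f` vanish for `t ≤ 0` while staying visibly continuous.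
  set f : ℝ → ℂ := fun t => Complex.exp (-((max t 0 : ℝ) * x)) - Complex.exp (-((max t 0 : ℝ) * p))
    with hf
  have hfc : Continuous f := by fun_prop
  have hf0 : ∀ t, t ≤ 0 → f t = 0 := fun t ht => by simp [hf, max_eq_right ht]
  have hf1 : ∀ t, 0 < t → f t = Complex.exp (-(0 + x) * t) - Complex.exp (-(0 + p) * t) :=
    fun t ht => by simp [hf, max_eq_left ht.le, mul_comm]
  have hfi0 : IntegrableOn f (Ioi 0) := by
    refine ((integrableOn_exp_neg_add hx 0 rfl).sub (integrableOn_exp_neg_add hp 0 rfl)).congr_fun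
      (fun t ht => (hf1 t ht).symm) measurableSet_Ioi
  have hfi : Integrable f := by
    rw [← integrableOn_univ, ← Iic_union_Ioi (a := (0 : ℝ))]
    refine IntegrableOn.union ?_ hfi0
    exact integrableOn_zero.congr_fun (fun t ht => (hf0 t ht).symm) measurableSet_Iic
  have hF : 𝓕 f = fun y => (imAxis y + x)⁻¹ - (imAxis y + p)⁻¹ := by
    funext y
    rw [Real.fourier_eq']
    rw [← setIntegral_eq_integral_of_forall_compl_eq_zero (s := Ioi 0)
      (fun t ht => by rw [hf0 t (not_lt.mp ht), smul_zero])]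
    rw [setIntegral_congr_fun (g := fun t : ℝ => Complex.exp (-(imAxis y + x) * t)
      - Complex.exp (-(imAxis y + p) * t)) measurableSet_Ioi]
    · rw [integral_sub (integrableOn_exp_neg_add hx _ (imAxis_re y))
        (integrableOn_exp_neg_add hp _ (imAxis_re y)),
        integral_exp_mul_complex_Ioi (by simp [hx]), integral_exp_mul_complex_Ioi (by simp [hp])]
      simp [div_eq_mul_inv, -neg_add_rev]
    · intro t ht
      simp only [hf1 t ht, smul_eq_mul, mul_sub, ← Complex.exp_add, imAxis]
      congr 2 <;> · simp; ring
  have hinv := hfi.fourierInv_fourier_eq (v := t) ?_ hfc.continuousAt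
  · rw [hF, Real.fourierInv_eq'] at hinv
    have e : f t = Complex.exp (-(t * x)) - Complex.exp (-(t * p)) := by simp [hf, max_eq_left ht]
    rw [← e, ← hinv, invLaplace]
    refine integral_congr_ae (Filter.Eventually.of_forall fun y => ?_)
    simp only [smul_eq_mul, imAxis]
    congr 2
    simp
    ring
  · rw [hF]
    simpa using integrable_inv_sub_inv hx hp 0

end InverseLaplace

/-! ### Scalar approximation of the exponential. -/

section ScalarApproximation

/-- Each exponential plus `invLaplace` term stands for the inverse transform of `B_j(s)/(s+p_j)` or
`B_l(s)/(s+x)`; the slowly decaying part `1/(s+·)` is inverted separately, as an exponential. -/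
lemma exp_sub_sum_takenaka {p : ℕ → ℝ} {a b x t : ℝ} (ha : 0 < a) (hp : ∀ i, p i ∈ Icc a b)
    (hx : a ≤ x) (ht : 0 ≤ t) (l : ℕ) :
    Complex.exp (-(t * x)) - ∑ j ∈ Finset.range l, (Complex.exp (-(t * p j))
        + invLaplace (fun s => (blaschke p j s - 1) / (s + p j)) t) * takenaka p j x
      = blaschke p l x * (Complex.exp (-(t * x))
        + invLaplace (fun s => (blaschke p l s - 1) / (s + x)) t) := by
  have hp0 : ∀ i, 0 < p i := fun i => ha.trans_le (hp i).1
  have hx0 : 0 < x := ha.trans_le hx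
  have hxp : ∀ i, (x : ℂ) + p i ≠ 0 := fun i => add_ofReal_ne_zero (by simpa using hx0.le) (hp0 i)
  have key : blaschke p l x * invLaplace (fun s => (blaschke p l s - 1) / (s + x)) t
      + ∑ j ∈ Finset.range l, takenaka p j x *
        invLaplace (fun s => (blaschke p j s - 1) / (s + p j)) t
      = ∑ j ∈ Finset.range l, takenaka p j x *
        (Complex.exp (-(t * x)) - Complex.exp (-(t * p j))) := by
    have e : ∀ j, Complex.exp (-(t * x)) - Complex.exp (-(t * p j))
        = invLaplace (fun s => (s + x)⁻¹ - (s + p j)⁻¹) t := fun j =>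
      (invLaplace_inv_sub_inv hx0 (hp0 j) ht).symm
    simp only [e, invLaplace, ← integral_const_mul]
    rw [← integral_finsetSum _ fun j _ =>
        (integrable_blaschke_integrand ha hp (hp j).1 j t).const_mul _,
      ← integral_finsetSum _ fun j _ => (integrable_inv_sub_inv hx0 (hp0 j) t).const_mul _,
      ← integral_add ((integrable_blaschke_integrand ha hp hx l t).const_mul _)
        (integrable_finsetSum _ fun j _ =>
          (integrable_blaschke_integrand ha hp (hp j).1 j t).const_mul _)]
    -- The claim is now a pointwise identity between integrands, a consequence of the two
    -- telescoping identities.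
    refine integral_congr_ae (Filter.Eventually.of_forall fun y => ?_)
    have hs : ∀ i, imAxis y + p i ≠ 0 := fun i => imAxis_add_ne_zero y (hp0 i)
    have hsx := imAxis_add_ne_zero y hx0
    have h1 := one_sub_blaschke hxp l
    have h2 := one_sub_blaschke_mul_blaschke hxp hs l
    have h3 : ∑ j ∈ Finset.range l, takenaka p j x * (blaschke p j (imAxis y) / (imAxis y + p j))
        = (1 - blaschke p l x * blaschke p l (imAxis y)) * (imAxis y + x)⁻¹ := by
      rw [h2]; field_simp
    have h4 : ∑ j ∈ Finset.range l, takenaka p j x * ((blaschke p j (imAxis y) - 1) / (imAxis y + p j))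
        - ∑ j ∈ Finset.range l, takenaka p j x * ((imAxis y + x)⁻¹ - (imAxis y + p j)⁻¹)
        = ∑ j ∈ Finset.range l, takenaka p j x * (blaschke p j (imAxis y) / (imAxis y + p j))
        - (∑ j ∈ Finset.range l, takenaka p j x) * (imAxis y + x)⁻¹ := by
      rw [Finset.sum_mul, ← Finset.sum_sub_distrib, ← Finset.sum_sub_distrib]
      refine Finset.sum_congr rfl fun j _ => ?_
      have := hs j
      field_simp
      ring
    rw [h3, ← h1] at h4
    simp only [mul_left_comm _ (Complex.exp _), ← Finset.mul_sum]
    rw [← mul_add]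
    congr 1
    linear_combination h4
  have h1 := one_sub_blaschke hxp l
  simp only [add_mul, Finset.sum_add_distrib]
  simp only [mul_sub, Finset.sum_sub_distrib, ← Finset.sum_mul, ← h1] at key
  simp only [mul_comm _ (takenaka _ _ _)]
  linear_combination -key

lemma one_add_le_two_mul_gammaConst {l : ℕ} (hl : 1 ≤ l) {κ : ℝ} (hκ : 1 ≤ κ) :
    1 + (4 + 2 * Real.log (l * κ)) / Real.pi ≤ 2 * gammaConst l κ := by
  have hpi := Real.pi_pos
  have hl0 : (1 : ℝ) ≤ l := by exact_mod_cast hl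
  have hκ0 : 0 < κ := by linarith
  -- Squaring the argument on the right gives `16 l² κ / π`, which exceeds `l κ` since `π ≤ 4` and
  -- `l ≥ 1`.
  have hlog : Real.log (l * κ) ≤ 2 * Real.log (4 * l * Real.sqrt (κ / Real.pi)) := by
    rw [← Real.log_rpow (by positivity), Real.rpow_two]
    refine Real.log_le_log (by positivity) ?_
    rw [mul_pow, Real.sq_sqrt (by positivity), ← mul_div_assoc, le_div_iff₀ hpi]
    have := Real.pi_le_four
    have h1 : (l : ℝ) * Real.pi ≤ (4 * l) ^ 2 := by nlinarith
    nlinarith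
  have h3 := Real.pi_gt_three
  have h4 : 4 / Real.pi ≤ 3 := by rw [div_le_iff₀ hpi]; linarith
  have h5 : 2 * Real.log (l * κ) / Real.pi
      ≤ 2 * (2 * Real.log (4 * l * Real.sqrt (κ / Real.pi))) / Real.pi := by gcongr
  have h6 : 2 * (2 * Real.log (4 * l * Real.sqrt (κ / Real.pi))) / Real.pi
    = 2 * (2 / Real.pi * Real.log (4 * l * Real.sqrt (κ / Real.pi))) := by ring
  rw [gammaConst, add_div]
  linarith

/-- Rational approximation of `x ↦ exp (-t x)` on `[a, b]` with denominator `∏ᵢ (z + pᵢ)`. -/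
theorem exists_rational_approx_exp {p : ℕ → ℝ} {a b t : ℝ} (ha : 0 < a) (hp : ∀ i, p i ∈ Icc a b)
    (ht : 0 ≤ t) {l : ℕ} (hl : 1 ≤ l) :
    ∃ P : Polynomial ℂ, P.natDegree ≤ l ∧ ∀ x : ℝ, a ≤ x →
      ‖Complex.exp (-(t * x)) - P.eval (x : ℂ) * (∏ i ∈ Finset.range l, ((x : ℂ) + p i))⁻¹‖
        ≤ 2 * gammaConst l (b / a) * ‖blaschke p l x‖ := by
  obtain ⟨P, hP, h⟩ := exists_polynomial_sum_takenaka p (fun j => Complex.exp (-(t * p j))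
        + invLaplace (fun s => (blaschke p j s - 1) / (s + p j)) t) l
  refine ⟨P, hP, fun x hx => ?_⟩
  have hx0 : 0 < x := ha.trans_le hx
  have hab : a ≤ b := (hp 0).1.trans (hp 0).2
  rw [← h x fun i => add_ofReal_ne_zero (by simpa using hx0.le) (ha.trans_le (hp i).1),
    exp_sub_sum_takenaka ha hp hx ht, norm_mul, mul_comm]
  refine mul_le_mul_of_nonneg_right ?_ (norm_nonneg _)
  refine le_trans ?_ (one_add_le_two_mul_gammaConst hl ((one_le_div ha).mpr hab))
  refine (norm_add_le _ _).trans (add_le_add ?_ (norm_invLaplace_blaschke_le ha hp hx hl))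
  rw [Complex.norm_exp, Real.exp_le_one_iff]
  simp
  positivity

end ScalarApproximation

end RatKrylov

namespace RatKrylov

open Set

/-! ### Exactness of the Krylov projection on rational functions. -/

section Compression

open Matrix Polynomial

variable {n s k l : ℕ}

lemma col_mul {m : ℕ} (X : Matrix (Fin m) (Fin n) ℂ) (v : Matrix (Fin n) (Fin s) ℂ) (c : Fin s) :
    (X * v).col c = X *ᵥ v.col c := rfl

/-- `U Uᴴ` fixes every matrix whose columns lie in the column space of `U`. -/
lemma mul_conjTranspose_mul_of_col_mem {U : Matrix (Fin n) (Fin k) ℂ} {W : Submodule ℂ (Fin n → ℂ)}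
    (hU : IsOrthonormalBasisOf U W) {w : Matrix (Fin n) (Fin s) ℂ} (hw : ∀ c, w.col c ∈ W) :
    U * (U.conjTranspose * w) = w := by
  refine Matrix.ext_col fun c => ?_
  have h := hw c
  rw [← hU.2, ← Matrix.range_mulVecLin] at h
  obtain ⟨y, hy⟩ := h
  rw [Matrix.mulVecLin_apply] at hy
  rw [← Matrix.mul_assoc, col_mul, ← hy, Matrix.mulVec_mulVec, Matrix.mul_assoc, hU.1, Matrix.mul_one]

/-- As long as the iterates stay in `W`, the projector `U Uᴴ` can be inserted after every
multiplication by `A`. -/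
lemma pow_mul_eq_compression {U : Matrix (Fin n) (Fin k) ℂ} {W : Submodule ℂ (Fin n → ℂ)}
    (hU : IsOrthonormalBasisOf U W) (A : Matrix (Fin n) (Fin n) ℂ) {w : Matrix (Fin n) (Fin s) ℂ}
    (hw : ∀ i ≤ l, ∀ c, (A ^ i * w).col c ∈ W) {i : ℕ} (hi : i ≤ l) :
    A ^ i * w = U * ((U.conjTranspose * A * U) ^ i * (U.conjTranspose * w)) := by
  induction i with
  | zero => simpa using (mul_conjTranspose_mul_of_col_mem hU (by simpa using hw 0 hi)).symm
  | succ i ih =>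
    have h := ih (by omega)
    rw [← mul_conjTranspose_mul_of_col_mem hU (hw (i + 1) hi), pow_succ', Matrix.mul_assoc A, h,
      pow_succ']
    simp only [Matrix.mul_assoc]

lemma aeval_mul_eq_compression {U : Matrix (Fin n) (Fin k) ℂ} {W : Submodule ℂ (Fin n → ℂ)}
    (hU : IsOrthonormalBasisOf U W) (A : Matrix (Fin n) (Fin n) ℂ) {w : Matrix (Fin n) (Fin s) ℂ}
    (hw : ∀ i ≤ l, ∀ c, (A ^ i * w).col c ∈ W) {P : ℂ[X]} (hP : P.natDegree ≤ l) :
    aeval A P * w = U * (aeval (U.conjTranspose * A * U) P * (U.conjTranspose * w)) := by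
  rw [aeval_eq_sum_range' (Nat.lt_succ_of_le hP), aeval_eq_sum_range' (Nat.lt_succ_of_le hP),
    Matrix.sum_mul, Matrix.sum_mul, Matrix.mul_sum]
  refine Finset.sum_congr rfl fun i hi => ?_
  rw [Matrix.smul_mul, Matrix.smul_mul, Matrix.mul_smul,
    pow_mul_eq_compression hU A hw (Nat.lt_succ_iff.mp (Finset.mem_range.mp hi))]

/-- Rational functions `P / q` with `deg P ≤ l` are reproduced exactly by the rational Krylov
projection. -/
lemma rational_mul_eq_compression {A : Matrix (Fin n) (Fin n) ℂ} {v : Matrix (Fin n) (Fin s) ℂ}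
    {ψ : Fin l → ℂ} {U : Matrix (Fin n) (Fin k) ℂ}
    (hU : IsOrthonormalBasisOf U (rationalKrylov A v ψ))
    (hq : IsUnit (aeval A (poleDenom ψ)))
    (hqU : IsUnit (aeval (U.conjTranspose * A * U) (poleDenom ψ)))
    {P : ℂ[X]} (hP : P.natDegree ≤ l) :
    aeval A P * (aeval A (poleDenom ψ))⁻¹ * v
      = U * (aeval (U.conjTranspose * A * U) P *
        (aeval (U.conjTranspose * A * U) (poleDenom ψ))⁻¹ * (U.conjTranspose * v)) := by
  set q := poleDenom ψ
  have hdet := (Matrix.isUnit_iff_isUnit_det _).mp hq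
  have hdetU := (Matrix.isUnit_iff_isUnit_det _).mp hqU
  have hcomm : ∀ i, A ^ i * (aeval A q)⁻¹ = (aeval A q)⁻¹ * A ^ i := fun i => by
    have h : aeval A q * A ^ i = A ^ i * aeval A q := by
      have := congrArg (aeval A) (mul_comm q (X ^ i))
      simpa only [map_mul, map_pow, aeval_X] using this
    calc A ^ i * (aeval A q)⁻¹ = (aeval A q)⁻¹ * (aeval A q * A ^ i) * (aeval A q)⁻¹ := by
          rw [← Matrix.mul_assoc, Matrix.nonsing_inv_mul _ hdet, Matrix.one_mul]
      _ = (aeval A q)⁻¹ * A ^ i := by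
          rw [h, Matrix.mul_assoc, Matrix.mul_assoc, Matrix.mul_nonsing_inv _ hdet, Matrix.mul_one]
  obtain ⟨w, hwdef⟩ : ∃ w, w = (aeval A q)⁻¹ * v := ⟨_, rfl⟩
  have hw : ∀ i ≤ l, ∀ c, (A ^ i * w).col c ∈ rationalKrylov A v ψ := fun i hi c => by
    refine Submodule.subset_span ⟨i, hi, c, ?_⟩
    rw [hwdef, ← Matrix.mul_assoc, hcomm]
  have hqdeg : q.natDegree ≤ l := by
    refine (Polynomial.natDegree_prod_le _ _).trans ?_
    simp
  -- Exactness for `q` itself reads `v = U q(A_l) Uᴴ w` with `w = q(A)⁻¹ v`; solving for `Uᴴ w`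
  -- brings in `q(A_l)⁻¹ Uᴴ v`.
  have h1 := aeval_mul_eq_compression hU A hw hqdeg
  have h0 : aeval A q * w = v := by
    rw [hwdef, ← Matrix.mul_assoc, Matrix.mul_nonsing_inv _ hdet, Matrix.one_mul]
  rw [h0] at h1
  have h2 : U.conjTranspose * w = (aeval (U.conjTranspose * A * U) q)⁻¹ * (U.conjTranspose * v) := by
    conv_rhs => rw [h1]
    rw [← Matrix.mul_assoc U.conjTranspose, hU.1, Matrix.one_mul, ← Matrix.mul_assoc,
      Matrix.nonsing_inv_mul _ hdetU, Matrix.one_mul]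
  rw [Matrix.mul_assoc, ← hwdef, aeval_mul_eq_compression hU A hw hP, h2,
    Matrix.mul_assoc (aeval (U.conjTranspose * A * U) P)]

end Compression

/-! ### Spectral inclusion and functional calculus. -/

section Spectrum

open Matrix

variable {n s k l : ℕ}

open scoped Pointwise in
-- The Loewner form `a ≤ B ≤ b` is what survives `B ↦ Uᴴ B U` when `Uᴴ U = 1`.
lemma spectrum_subset_Icc_iff {B : Matrix (Fin n) (Fin n) ℂ} (hB : B.IsHermitian) {a b : ℝ} :
    spectrum ℂ B ⊆ Complex.ofReal '' Icc a b ↔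
      (B - (a : ℂ) • 1).PosSemidef ∧ ((b : ℂ) • 1 - B).PosSemidef := by
  have hsm : ∀ r : ℝ, ((r : ℂ) • (1 : Matrix (Fin n) (Fin n) ℂ)).IsHermitian := fun r => by
    simp [Matrix.IsHermitian, Matrix.conjTranspose_smul]
  have h1 : spectrum ℂ (B - (a : ℂ) • 1) = spectrum ℂ B - ({(a : ℂ)} : Set ℂ) := by
    rw [← Algebra.algebraMap_eq_smul_one, spectrum.sub_singleton_eq]
  have h2 : spectrum ℂ ((b : ℂ) • 1 - B) = ({(b : ℂ)} : Set ℂ) - spectrum ℂ B := by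
    rw [← Algebra.algebraMap_eq_smul_one, spectrum.singleton_sub_eq]
  rw [posSemidef_iff_isHermitian_and_spectrum_nonneg, posSemidef_iff_isHermitian_and_spectrum_nonneg,
    h1, h2, Set.sub_singleton, Set.singleton_sub, Set.image_subset_iff, Set.image_subset_iff]
  simp only [hB.sub (hsm a), (hsm b).sub hB, true_and]
  constructor
  · intro h
    constructor
    · intro z hz
      obtain ⟨x, hx, rfl⟩ := h hz
      simpa using hx.1
    · intro z hz
      obtain ⟨x, hx, rfl⟩ := h hz
      simpa using hx.2
  · rintro ⟨ha, hb⟩ z hz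
    have h3 : (a : ℂ) ≤ z := by simpa using ha hz
    have h4 : z ≤ (b : ℂ) := by simpa using hb hz
    rw [Complex.le_def] at h3 h4
    exact ⟨z.re, ⟨by simpa using h3.1, by simpa using h4.1⟩, Complex.ext rfl (by simpa using h3.2)⟩

lemma spectrum_compression_subset {A : Matrix (Fin n) (Fin n) ℂ} (hA : A.IsHermitian) {a b : ℝ}
    (h : spectrum ℂ A ⊆ Complex.ofReal '' Icc a b) {U : Matrix (Fin n) (Fin k) ℂ}
    (hU : U.conjTranspose * U = 1) :
    spectrum ℂ (U.conjTranspose * A * U) ⊆ Complex.ofReal '' Icc a b := by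
  rw [spectrum_subset_Icc_iff hA] at h
  rw [spectrum_subset_Icc_iff (isHermitian_conjTranspose_mul_mul U hA)]
  have h1 := h.1.conjTranspose_mul_mul_same U
  have h2 := h.2.conjTranspose_mul_mul_same U
  simp only [Matrix.mul_sub, Matrix.sub_mul, Matrix.mul_smul, Matrix.smul_mul, Matrix.mul_one, hU]
    at h1 h2
  exact ⟨h1, h2⟩

lemma isUnit_aeval_of_spectrum {B : Matrix (Fin n) (Fin n) ℂ} (hB : B.IsHermitian) {q : Polynomial ℂ}
    (hq : ∀ z ∈ spectrum ℂ B, q.eval z ≠ 0) : IsUnit (Polynomial.aeval B q) := by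
  have hn : IsStarNormal B := hB.isSelfAdjoint.isStarNormal
  rw [← cfc_polynomial q B]
  exact (isUnit_cfc_iff _ _ (by fun_prop)).mpr hq

lemma norm_exp_sub_rational_le {B : Matrix (Fin n) (Fin n) ℂ} (hB : B.IsHermitian) {P q : Polynomial ℂ}
    (hq : ∀ z ∈ spectrum ℂ B, q.eval z ≠ 0) {t C : ℝ} (hC : 0 ≤ C)
    (h : ∀ z ∈ spectrum ℂ B, ‖Complex.exp (-(t * z)) - P.eval z * (q.eval z)⁻¹‖ ≤ C) :
    ‖NormedSpace.exp (-(t : ℂ) • B) - Polynomial.aeval B P * (Polynomial.aeval B q)⁻¹‖ ≤ C := by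
  have hn : IsStarNormal B := hB.isSelfAdjoint.isStarNormal
  have e1 : NormedSpace.exp (-(t : ℂ) • B) = cfc (fun z : ℂ => Complex.exp (-(t * z))) B := by
    have hn' : IsStarNormal (-(t : ℂ) • B) := inferInstance
    rw [← CFC.exp_eq_normedSpace_exp (𝕜 := ℂ) hn', ← Complex.exp_eq_exp_ℂ,
      ← cfc_comp_const_mul (-(t : ℂ)) Complex.exp B]
    simp
  have hqc : ContinuousOn (fun z => (q.eval z)⁻¹) (spectrum ℂ B) :=
    ContinuousOn.inv₀ (by fun_prop) hq
  have e2 : Polynomial.aeval B P * (Polynomial.aeval B q)⁻¹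
      = cfc (fun z : ℂ => P.eval z * (q.eval z)⁻¹) B := by
    rw [cfc_mul (fun z => P.eval z) (fun z => (q.eval z)⁻¹) B (by fun_prop) hqc,
      cfc_inv (fun z => q.eval z) B hq, cfc_polynomial P B, cfc_polynomial q B,
      Matrix.nonsing_inv_eq_ringInverse]
  rw [e1, e2, ← cfc_sub (fun z : ℂ => Complex.exp (-(t * z))) (fun z => P.eval z * (q.eval z)⁻¹) B
    (by fun_prop) (ContinuousOn.mul (by fun_prop) hqc)]
  exact norm_cfc_le hC h

end Spectrum
end RatKrylov

/-! ### Real poles, the maximum of `|r_Ψ|`, and the error bound. -/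

namespace RatKrylov

open Set

lemma eval_poleDenom {l : ℕ} (ψ : Fin l → ℝ) {p : ℕ → ℝ} (hp : ∀ j : Fin l, p j = -ψ j) (z : ℂ) :
    (poleDenom fun j => (ψ j : ℂ)).eval z = ∏ i ∈ Finset.range l, (z + p i) := by
  rw [poleDenom, Polynomial.eval_prod, Finset.prod_range]
  refine Finset.prod_congr rfl fun j _ => ?_
  simp [hp, sub_eq_add_neg]

lemma abs_rPole_eq {l : ℕ} (ψ : Fin l → ℝ) {p : ℕ → ℝ} (hp : ∀ j : Fin l, p j = -ψ j) (x : ℝ) :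
    |rPole ψ x| = ‖blaschke p l x‖ := by
  rw [← Real.norm_eq_abs, ← Complex.norm_real, rPole, blaschke, Finset.prod_range]
  push_cast
  congr 1
  refine Finset.prod_congr rfl fun j _ => ?_
  simp [hp, sub_eq_add_neg]

lemma exists_isGreatest_abs_rPole {l : ℕ} {a b : ℝ} (ha : 0 < a) (hab : a ≤ b) {ψ : Fin l → ℝ}
    (hψ : ∀ j, ψ j ∈ Icc (-b) (-a)) :
    ∃ M : ℝ, IsGreatest ((fun z => |rPole ψ z|) '' Icc a b) M := by
  refine (isCompact_Icc.image_of_continuousOn ?_).exists_isGreatest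
    ((nonempty_Icc.mpr hab).image _)
  refine ContinuousOn.abs ?_
  unfold rPole
  refine continuousOn_finsetProd _ fun j _ => ContinuousOn.div (by fun_prop) (by fun_prop) ?_
  intro z hz
  have := (hψ j).2
  have := hz.1
  exact ne_of_gt (by linarith)

lemma norm_le_one_of_conjTranspose_mul_self {n k : ℕ} {U : Matrix (Fin n) (Fin k) ℂ}
    (hU : U.conjTranspose * U = 1) : ‖U‖ ≤ 1 := by
  have h := Matrix.l2_opNorm_conjTranspose_mul_self U
  rw [hU] at h
  have h1 : ‖(1 : Matrix (Fin k) (Fin k) ℂ)‖ ≤ 1 := by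
    rcases isEmpty_or_nonempty (Fin k) with hk | hk
    · rw [Subsingleton.elim (1 : Matrix (Fin k) (Fin k) ℂ) 0, norm_zero]
      exact zero_le_one
    · exact norm_one.le
  nlinarith [norm_nonneg U]

end RatKrylov

/-- Norms of matrices are spectral (Euclidean operator) norms; for a one-column matrix this is the
Euclidean norm of the column. -/
theorem mainTheorem7 {n s k l : ℕ} (hl : 1 ≤ l)
    (a b : ℝ) (ha : 0 < a) (hab : a ≤ b)
    (A : Matrix (Fin n) (Fin n) ℂ) (hA : A.PosDef)
    (hspec : spectrum ℂ A ⊆ Complex.ofReal '' Set.Icc a b)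
    (v : Matrix (Fin n) (Fin s) ℂ)
    (ψ : Fin l → ℝ) (hψ : ∀ j, ψ j ∈ Set.Icc (-b) (-a))
    (U : Matrix (Fin n) (Fin k) ℂ)
    (hU : RatKrylov.IsOrthonormalBasisOf U
      (RatKrylov.rationalKrylov A v (fun j => (ψ j : ℂ)))) :
    ∃ M : ℝ, IsGreatest ((fun z => |RatKrylov.rPole ψ z|) '' Set.Icc a b) M ∧
      ∀ t : ℝ, 0 ≤ t →
        ‖NormedSpace.exp (-(t : ℂ) • A) * v
            - U * (NormedSpace.exp (-(t : ℂ) • (U.conjTranspose * A * U))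
              * (U.conjTranspose * v))‖
          ≤ 4 * RatKrylov.gammaConst l (b / a) * ‖v‖ * M := by
  obtain ⟨M, hM⟩ := RatKrylov.exists_isGreatest_abs_rPole ha hab hψ
  refine ⟨M, hM, fun t ht => ?_⟩
  -- The value `a` beyond index `l` only keeps the whole sequence in `[a, b]`; products over `i < l`
  -- never see it.
  set p : ℕ → ℝ := fun i => if h : i < l then -ψ ⟨i, h⟩ else a with hpdef
  have hpψ : ∀ j : Fin l, p j = -ψ j := fun j => by simp [hpdef]
  have hp : ∀ i, p i ∈ Set.Icc a b := fun i => by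
    by_cases h : i < l
    · have := hψ ⟨i, h⟩
      simp only [hpdef, h, dif_pos]
      exact ⟨by linarith [this.2], by linarith [this.1]⟩
    · simp only [hpdef, h, dif_neg, not_false_iff]
      exact ⟨le_rfl, hab⟩
  set q := RatKrylov.poleDenom fun j => (ψ j : ℂ) with hqdef
  have hq : ∀ z ∈ Complex.ofReal '' Set.Icc a b, q.eval z ≠ 0 := by
    rintro _ ⟨x, hx, rfl⟩
    rw [hqdef, RatKrylov.eval_poleDenom ψ hpψ]
    exact Finset.prod_ne_zero_iff.mpr fun i _ => RatKrylov.add_ofReal_ne_zero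
      (by simpa using ha.le.trans hx.1) (ha.trans_le (hp i).1)
  obtain ⟨P, hP, happrox⟩ := RatKrylov.exists_rational_approx_exp ha hp ht hl
  have hM0 : 0 ≤ M := by
    obtain ⟨x, _, rfl⟩ := hM.1
    exact abs_nonneg _
  have hκ : 1 ≤ b / a := (one_le_div ha).mpr hab
  have hγ : 0 ≤ 2 * RatKrylov.gammaConst l (b / a) := by
    refine le_trans ?_ (RatKrylov.one_add_le_two_mul_gammaConst hl hκ)
    have : 0 ≤ Real.log (l * (b / a)) := Real.log_nonneg
      (one_le_mul_of_one_le_of_one_le (by exact_mod_cast hl) hκ)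
    have := Real.pi_pos
    positivity
  set C := 2 * RatKrylov.gammaConst l (b / a) * M with hCdef
  have hC : 0 ≤ C := mul_nonneg hγ hM0
  have hbound : ∀ z ∈ Complex.ofReal '' Set.Icc a b,
      ‖Complex.exp (-(t * z)) - P.eval z * (q.eval z)⁻¹‖ ≤ C := by
    rintro _ ⟨x, hx, rfl⟩
    rw [hqdef, RatKrylov.eval_poleDenom ψ hpψ]
    refine (happrox x hx.1).trans (mul_le_mul_of_nonneg_left ?_ hγ)
    rw [← RatKrylov.abs_rPole_eq ψ hpψ]
    exact hM.2 ⟨x, hx, rfl⟩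
  set B := U.conjTranspose * A * U with hBdef
  have hBh : B.IsHermitian := Matrix.isHermitian_conjTranspose_mul_mul U hA.isHermitian
  have hBspec : spectrum ℂ B ⊆ Complex.ofReal '' Set.Icc a b :=
    RatKrylov.spectrum_compression_subset hA.isHermitian hspec hU.1
  have hqA := fun z hz => hq z (hspec hz)
  have hqB := fun z hz => hq z (hBspec hz)
  have hexact := RatKrylov.rational_mul_eq_compression hU
    (RatKrylov.isUnit_aeval_of_spectrum hA.isHermitian hqA)
    (RatKrylov.isUnit_aeval_of_spectrum hBh hqB) hP
  have hEA := RatKrylov.norm_exp_sub_rational_le hA.isHermitian hqA hC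
    fun z hz => hbound z (hspec hz)
  have hEB := RatKrylov.norm_exp_sub_rational_le hBh hqB hC fun z hz => hbound z (hBspec hz)
  have hU1 := RatKrylov.norm_le_one_of_conjTranspose_mul_self hU.1
  have hU2 : ‖U.conjTranspose‖ ≤ 1 := by rwa [Matrix.l2_opNorm_conjTranspose]
  set RA := Polynomial.aeval A P * (Polynomial.aeval A q)⁻¹
  set RB := Polynomial.aeval B P * (Polynomial.aeval B q)⁻¹
  -- By exactness `RA * v = U * (RB * (Uᴴ * v))`, so both may be subtracted; the two defects
  -- contribute `C * ‖v‖` each, whence `4 = 2 · 2`.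
  have hsplit : NormedSpace.exp (-(t : ℂ) • A) * v
      - U * (NormedSpace.exp (-(t : ℂ) • B) * (U.conjTranspose * v))
      = (NormedSpace.exp (-(t : ℂ) • A) - RA) * v
        - U * ((NormedSpace.exp (-(t : ℂ) • B) - RB) * (U.conjTranspose * v)) := by
    rw [Matrix.sub_mul, Matrix.sub_mul, Matrix.mul_sub, hexact]
    abel
  have h1 : ‖(NormedSpace.exp (-(t : ℂ) • A) - RA) * v‖ ≤ C * ‖v‖ :=
    (Matrix.l2_opNorm_mul _ _).trans (mul_le_mul_of_nonneg_right hEA (norm_nonneg _))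
  have h2 : ‖U * ((NormedSpace.exp (-(t : ℂ) • B) - RB) * (U.conjTranspose * v))‖ ≤ C * ‖v‖ := by
    refine (Matrix.l2_opNorm_mul _ _).trans ((mul_le_of_le_one_left (norm_nonneg _) hU1).trans ?_)
    refine (Matrix.l2_opNorm_mul _ _).trans (mul_le_mul hEB ?_ (norm_nonneg _) hC)
    exact (Matrix.l2_opNorm_mul _ _).trans (mul_le_of_le_one_left (norm_nonneg _) hU2)
  rw [hsplit]
  refine (norm_sub_le _ _).trans ((add_le_add h1 h2).trans_eq ?_)
  rw [hCdef]
  ring
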